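/- Let $U_\infty=\bigcup_n U_n$ be the direct limit of the unitary groups $U_n$ (with respect to the inclusions $u\mapsto\mathrm{diag}(u,1)$), equipped with the operator norm, and let $I$ be its unit. For a finite presentation $\Gamma=\langle g_1,\dots,g_k\mid r_1,\dots,r_l\rangle$ and a tuple $\sigma=(u_1,\dots,u_k)\in U_\infty^k$ put $|||\sigma|||=\max_j\|r_j(u_1,\dots,u_k)-I\|$ (with $u_i^{-1}$ substituted for $g_i^{-1}$). The tuple $\sigma$ is an $\varepsilon$-almost representation of $\Gamma$ if $|||\sigma|||\le\varepsilon$; the set of these is $R_\varepsilon(\Gamma)\subset U_\infty^k$. An asymptotic representation is a norm-continuous family $(\sigma_t)_{t\in[0,\infty)}$ in $U_\infty^k$ with $|||\sigma_t|||\to0$ as $t\to\infty$. The presented group $\Gamma$ has the property AGA if there is a function $\delta$ on $(0,\infty)$ with $\delta(\varepsilon)\to0$ as $\varepsilon\to0$ such that for every $\varepsilon>0$ and every $\sigma\in R_\varepsilon(\Gamma)$ there is an asymptotic representation $(\sigma_t)$ with $\sigma_0=\sigma$ and $|||\sigma_t|||\le\delta(\varepsilon)$ for all $t\ge0$. Let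 $\Gamma=\langle a_1,b_1,\dots,a_m,b_m\mid a_1b_1a_1^{-1}b_1^{-1}\cdots a_mb_ma_m^{-1}b_m^{-1}\rangle$ be the fundamental group of the closed oriented surface of genus $m$, with this presentation. (1) For every $\varepsilon>0$, every $\varepsilon$-almost representation $\sigma$ of $\Gamma$ is connected, by a norm-continuous path lying in $R_{2\varepsilon}(\Gamma)$, with a $2\varepsilon$-almost representation whose values $u_i$ at $a_i$ and $v_i$ at $b_i$ satisfy $u_2=v_2=\dots=u_m=v_m=I$. (2) If $\mathbb Z^2=\langle a,b\mid aba^{-1}b^{-1}\rangle$ has the property AGA, then so has $\Gamma$. -/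

import Mathlib

open Filter Topology
open scoped NNReal

namespace AGA

/-- The Hilbert space `ℓ²(ℕ)` over the complex numbers. -/
abbrev Hilb : Type := lp (fun _ : ℕ => ℂ) 2

/-- The `k`-th vector of the standard orthonormal basis of `ℓ²(ℕ)`. -/
noncomputable def stdVec (k : ℕ) : Hilb := lp.single 2 k (1 : ℂ)

/-- The group `U_n`, embedded in the unitary operators of `ℓ²(ℕ)` by `u ↦ diag(u, 1, 1, …)`.
A unitary operator that fixes all the basis vectors `e_k` with `k ≥ n` also preserves their
orthogonal complement, the span of `e_0, …, e_{n-1}`, so these are exactly the operators of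
the form `diag(u, 1, 1, …)` with `u` a unitary `n × n` matrix. -/
noncomputable def unitaryFin (n : ℕ) : Subgroup (unitary (Hilb →L[ℂ] Hilb)) where
  carrier := {u | ∀ k, n ≤ k → (u : Hilb →L[ℂ] Hilb) (stdVec k) = stdVec k}
  mul_mem' := by
    intro u v hu hv k hk
    show (u : Hilb →L[ℂ] Hilb) ((v : Hilb →L[ℂ] Hilb) (stdVec k)) = stdVec k
    rw [hv k hk, hu k hk]
  one_mem' := fun _ _ => rfl
  inv_mem' := by
    intro u hu k hk
    have h : ((u⁻¹ * u : unitary (Hilb →L[ℂ] Hilb)) : Hilb →L[ℂ] Hilb) (stdVec k)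
        = stdVec k := by
      rw [inv_mul_cancel]; rfl
    change ((u⁻¹ : unitary (Hilb →L[ℂ] Hilb)) : Hilb →L[ℂ] Hilb)
      ((u : Hilb →L[ℂ] Hilb) (stdVec k)) = stdVec k at h
    rwa [hu k hk] at h

theorem unitaryFin_mono {m n : ℕ} (h : m ≤ n) : unitaryFin m ≤ unitaryFin n :=
  fun _ hu k hk => hu k (h.trans hk)

/-- The group `U_∞`, the increasing union (direct limit) of the groups `U_n`. -/
noncomputable def unitaryInf : Subgroup (unitary (Hilb →L[ℂ] Hilb)) where
  carrier := {u | ∃ n, u ∈ unitaryFin n}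
  mul_mem' := by
    rintro u v ⟨m, hu⟩ ⟨n, hv⟩
    exact ⟨max m n, mul_mem (unitaryFin_mono (le_max_left m n) hu)
      (unitaryFin_mono (le_max_right m n) hv)⟩
  one_mem' := ⟨0, one_mem _⟩
  inv_mem' := by
    rintro u ⟨n, hu⟩
    exact ⟨n, inv_mem hu⟩

/-- `U_∞` as a type; its topology is the one of the operator norm. -/
abbrev UInf : Type := unitaryInf

/-- The underlying bounded operator of an element of `U_∞`. -/
abbrev UInf.toOp (u : UInf) : Hilb →L[ℂ] Hilb :=
  ((u : unitary (Hilb →L[ℂ] Hilb)) : Hilb →L[ℂ] Hilb)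

/-- `‖r(σ) - I‖` (operator norm), where the word `r` is evaluated at the unitaries `σ`. -/
noncomputable def relDefect {α : Type} (σ : α → UInf) (r : FreeGroup α) : ℝ :=
  ‖UInf.toOp (FreeGroup.lift σ r) - 1‖

/-- `R_ε(Γ)`: the set of all `ε`-almost representations of `Γ = ⟨α | rels⟩`. -/
def almostReps {α : Type} (rels : Finset (FreeGroup α)) (ε : ℝ) : Set (α → UInf) :=
  {σ | ∀ r ∈ rels, relDefect σ r ≤ ε}

/-- The deviation `max_j ‖r_j(σ) - I‖`, over the finitely many relators `r_j`. -/
noncomputable def deviation {α : Type} (rels : Finset (FreeGroup α)) (σ : α → UInf) : ℝ :=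
  ⨆ r : rels, relDefect σ (r : FreeGroup α)

/-- Asymptotic representations of `Γ = ⟨α | rels⟩`: norm-continuous families `σ_t`,
`t ∈ [0, ∞)`, whose deviation tends to zero as `t → ∞`. -/
def IsAsymptoticRep {α : Type} (rels : Finset (FreeGroup α)) (σ : ℝ≥0 → α → UInf) : Prop :=
  Continuous σ ∧ Tendsto (fun t => deviation rels (σ t)) atTop (𝓝 0)

/-- The property AGA (almost representations generate asymptotic representations) of the
group presented by `⟨α | rels⟩`. -/
def HasAGA {α : Type} (rels : Finset (FreeGroup α)) : Prop :=
  ∃ δ : ℝ → ℝ, Tendsto δ (𝓝[>] 0) (𝓝 0) ∧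
    ∀ ε : ℝ, 0 < ε → ∀ σ ∈ almostReps rels ε,
      ∃ σt : ℝ≥0 → α → UInf, IsAsymptoticRep rels σt ∧ σt 0 = σ ∧
        ∀ t, deviation rels (σt t) ≤ δ ε

/-- Generators of the surface group of genus `m`: `inl i` is `a_{i+1}`, `inr i` is `b_{i+1}`
for `i = 0, …, m - 1`. -/
abbrev SurfaceGen (m : ℕ) : Type := Fin m ⊕ Fin m

/-- The word `a_1 b_1 a_1⁻¹ b_1⁻¹ ⋯ a_m b_m a_m⁻¹ b_m⁻¹`. -/
def surfaceWord (m : ℕ) : FreeGroup (SurfaceGen m) :=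
  (List.ofFn fun i : Fin m =>
    FreeGroup.of (Sum.inl i) * FreeGroup.of (Sum.inr i) *
      (FreeGroup.of (Sum.inl i))⁻¹ * (FreeGroup.of (Sum.inr i))⁻¹).prod

/-- The single relator of the fundamental group of the closed oriented surface of genus `m`. -/
def surfaceRels (m : ℕ) : Finset (FreeGroup (SurfaceGen m)) := {surfaceWord m}

/-- The relator of `ℤ² = ⟨a, b | a b a⁻¹ b⁻¹⟩`, with `a = 0` and `b = 1` in `Fin 2`. -/
def zSqRels : Finset (FreeGroup (Fin 2)) :=
  {FreeGroup.of 0 * FreeGroup.of 1 * (FreeGroup.of 0)⁻¹ * (FreeGroup.of 1)⁻¹}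

end AGA

/-! ### Paths in unitary groups and norms of block diagonal matrices. -/

open scoped Matrix.Norms.L2Operator
open scoped commutatorElement

/-! All entries of `σ` lie in one `U_n`, which is path connected, so every pair but the first can be
contracted to `(1, 1)`. Along the way the commutator of the first pair must compensate: it should
follow a prescribed path `C` from `⁅u, v⁆`, up to an error `ε`, so that the relator stays within `ε`
of its initial value and within `2ε` of `1`.

Such approximate lifting (`exists_commutator_lift`) uses the extra room in `U_∞`. Deform `(u ⊕ 1, v
⊕ 1)` to `(u ⊕ ⋯ ⊕ u, (v ⊕ 1) V)`, with `V` a cyclic permutation of the blocks, keeping the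
commutator constant (`joinedIn_blockPerm`). Then replace the blocks `u` by slowly varying ones.
Conjugation by `V` compares neighbouring blocks: the jump at block `0` produces `C s`, while each
other block contributes a quotient of two nearby values of `C`, close to `1`.

Once only one pair is nontrivial, the relator is that of `ℤ²`, and AGA transfers by concatenating
paths. -/

theorem Unitary.expUnitary_argSelfAdjoint_of_finite_spectrum {A : Type*} [CStarAlgebra A]
    (u : unitary A) (h : (spectrum ℂ (u : A)).Finite) :
    selfAdjoint.expUnitary (Unitary.argSelfAdjoint u) = u := by
  ext
  -- Finiteness makes the discontinuity of `arg` on the negative axis harmless.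
  have : ContinuousOn Complex.arg (spectrum ℂ (u : A)) := h.continuousOn _
  rw [selfAdjoint.expUnitary_coe, Unitary.argSelfAdjoint_coe, ← CFC.exp_eq_normedSpace_exp (𝕜 := ℂ),
    ← cfc_comp_smul .., ← cfc_comp' ..]
  conv_rhs => rw [← cfc_id' ℂ (u : A)]
  refine cfc_congr fun y hy ↦ ?_
  have hy₁ : ‖y‖ = 1 := spectrum.norm_eq_one_of_unitary u.2 hy
  have h0 : y ≠ 0 := by rintro rfl; simp at hy₁
  have : Complex.I * y.arg = Complex.log y :=
    Complex.ext (by simp [Complex.log_re, hy₁]) (by simp [Complex.log_im])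
  simpa [← Complex.exp_eq_exp_ℂ, this] using Complex.exp_log h0

/-- The path is `exp(i t arg u)`. Since `arg u` comes from the functional calculus of `u`, it
commutes with every unitary commuting with `u`. -/
theorem Unitary.exists_path_commute {A : Type*} [CStarAlgebra A]
    (u : unitary A) (h : (spectrum ℂ (u : A)).Finite) :
    ∃ γ : Path 1 u, ∀ (t : unitInterval) (x : unitary A), Commute x u → Commute x (γ t) := by
  have hu := Unitary.expUnitary_argSelfAdjoint_of_finite_spectrum u h
  refine ⟨(selfAdjoint.expUnitaryPathToOne (Unitary.argSelfAdjoint u)).cast rfl hu.symm, ?_⟩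
  intro t x hx
  have h1 : Commute (x : A) (u : A) := congrArg Subtype.val hx
  have h2 : Commute (x : A) (star (u : A)) := congrArg Subtype.val hx.inv_right
  have h3 : Commute (x : A) (Unitary.argSelfAdjoint u : A) :=
    (Commute.cfc h1.symm h2.symm _).symm
  apply Subtype.ext
  simp only [Path.cast_coe, selfAdjoint.expUnitaryPathToOne_apply]
  change Commute (x : A) (selfAdjoint.expUnitary ((t : ℝ) • Unitary.argSelfAdjoint u) : A)
  rw [selfAdjoint.expUnitary_coe]
  apply Commute.exp_right
  apply Commute.smul_right
  exact h3.smul_right (t : ℝ)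

instance Matrix.pathConnectedSpace_unitary {n : Type*} [Fintype n] [DecidableEq n] :
    PathConnectedSpace (unitary (Matrix n n ℂ)) :=
  .mk ⟨1⟩ fun u v =>
    (Unitary.exists_path_commute u (Matrix.finite_spectrum _)).elim fun γ _ =>
    (Unitary.exists_path_commute v (Matrix.finite_spectrum _)).elim fun γ' _ =>
      ⟨γ.symm.trans γ'⟩

/-- A star homomorphism between C⋆-algebras is contractive. The product carries the sup norm, so
errors can be estimated block by block. -/
theorem Matrix.norm_blockDiagonal_le {m o : Type*} [Fintype m] [DecidableEq m] [Fintype o]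
    [DecidableEq o] (x : o → Matrix m m ℂ) :
    ‖Matrix.blockDiagonal x‖ ≤ ‖x‖ := by
  let φ : (o → Matrix m m ℂ) →⋆ₐ[ℂ] Matrix (m × o) (m × o) ℂ :=
    { Matrix.blockDiagonalRingHom m o ℂ with
      commutes' := fun r => by
        simp [Algebra.algebraMap_eq_smul_one, Matrix.blockDiagonal_smul]
      map_star' := fun y => (Matrix.blockDiagonal_conjTranspose y).symm }
  exact NonUnitalStarAlgHom.norm_apply_le φ x

/-! ### Unitary matrices as elements of `U_∞`. -/

namespace AGA

theorem inner_stdVec (j k : ℕ) :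
    inner ℂ (stdVec j) (stdVec k) = if j = k then 1 else 0 := by
  rw [stdVec, lp.inner_single_left, stdVec]
  by_cases h : j = k
  · subst h; simp
  · rw [if_neg h, lp.single_apply_ne 2 k _ h, inner_zero_right]

theorem op_ext {S T : Hilb →L[ℂ] Hilb} (h : ∀ k, S (stdVec k) = T (stdVec k)) : S = T := by
  refine lp.ext_continuousLinearMap (by simp) fun k => ?_
  ext1
  exact h k

/-- The matrix `M`, as an operator on the span of the basis vectors with index in the range
of `e`, extended by zero. -/
noncomputable def matrixOp {ι : Type*} [Fintype ι] (e : ι ↪ ℕ) (M : Matrix ι ι ℂ) :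
    Hilb →L[ℂ] Hilb :=
  ∑ p, ∑ q, M p q • InnerProductSpace.rankOne ℂ (stdVec (e p)) (stdVec (e q))

theorem matrixOp_stdVec_of_notMem {ι : Type*} [Fintype ι] (e : ι ↪ ℕ) (M : Matrix ι ι ℂ) {k : ℕ}
    (hk : k ∉ Set.range e) : matrixOp e M (stdVec k) = 0 := by
  have h : ∀ q, e q ≠ k := fun q hq => hk ⟨q, hq⟩
  simp [matrixOp, inner_stdVec, h]

theorem exists_bound_embedding {ι : Type*} [Fintype ι] (e : ι ↪ ℕ) : ∃ n, ∀ p, e p < n :=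
  ⟨Finset.univ.sup e + 1, fun p => Nat.lt_succ_of_le (Finset.le_sup (f := e) (Finset.mem_univ p))⟩

variable {ι : Type*} [Fintype ι] [DecidableEq ι]

theorem matrixOp_stdVec (e : ι ↪ ℕ) (M : Matrix ι ι ℂ) (q : ι) :
    matrixOp e M (stdVec (e q)) = ∑ p, M p q • stdVec (e p) := by
  simp [matrixOp, inner_stdVec]

theorem inner_matrixOp (e : ι ↪ ℕ) (M : Matrix ι ι ℂ) (p q : ι) :
    inner ℂ (stdVec (e p)) (matrixOp e M (stdVec (e q))) = M p q := by
  simp only [matrixOp_stdVec, inner_sum, inner_smul_right, inner_stdVec]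
  simp

theorem matrixOp_injective (e : ι ↪ ℕ) : Function.Injective (matrixOp e) := by
  intro M N h
  ext p q
  rw [← inner_matrixOp e M, h, inner_matrixOp]

/-- `matrixOp e` as a homomorphism of star algebras. -/
noncomputable def matrixOpHom (e : ι ↪ ℕ) : Matrix ι ι ℂ →⋆ₙₐ[ℂ] (Hilb →L[ℂ] Hilb) where
  toFun := matrixOp e
  map_smul' c M := by simp [matrixOp, Finset.smul_sum, smul_smul]
  map_zero' := by simp [matrixOp]
  map_add' M N := by simp [matrixOp, add_smul, Finset.sum_add_distrib]
  map_mul' M N := by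
    refine op_ext fun k => ?_
    by_cases hk : k ∈ Set.range e
    · obtain ⟨q, rfl⟩ := hk
      simp only [mul_apply_eq_comp, matrixOp_stdVec, map_sum, map_smul,
        Matrix.mul_apply, Finset.sum_smul, Finset.smul_sum, smul_smul]
      rw [Finset.sum_comm]
      simp only [mul_comm]
    · simp [matrixOp_stdVec_of_notMem e _ hk]
  map_star' M := by
    simp only [matrixOp, star_sum, star_smul, ContinuousLinearMap.star_eq_adjoint,
      InnerProductSpace.adjoint_rankOne, Matrix.conjTranspose_apply, Matrix.star_eq_conjTranspose]
    rw [Finset.sum_comm]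

theorem matrixOpHom_apply (e : ι ↪ ℕ) (M : Matrix ι ι ℂ) : matrixOpHom e M = matrixOp e M := rfl

/-- The operator which is `M` on the span of the basis vectors with index in the range of `e`
and the identity on its orthogonal complement. -/
noncomputable def stabilize (e : ι ↪ ℕ) (M : Matrix ι ι ℂ) : Hilb →L[ℂ] Hilb :=
  1 + matrixOpHom e (M - 1)

theorem stabilize_one (e : ι ↪ ℕ) : stabilize e (1 : Matrix ι ι ℂ) = 1 := by
  simp [stabilize]

theorem stabilize_mul (e : ι ↪ ℕ) (M N : Matrix ι ι ℂ) :
    stabilize e (M * N) = stabilize e M * stabilize e N := by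
  have : M * N - 1 = (M - 1) + (N - 1) + (M - 1) * (N - 1) := by noncomm_ring
  rw [stabilize, this, map_add, map_add, map_mul, stabilize, stabilize]
  noncomm_ring

theorem stabilize_star (e : ι ↪ ℕ) (M : Matrix ι ι ℂ) :
    stabilize e (star M) = star (stabilize e M) := by
  rw [stabilize, stabilize, star_add, star_one, ← map_star, star_sub, star_one]

theorem stabilize_injective (e : ι ↪ ℕ) : Function.Injective (stabilize e) :=
  fun _ _ h => sub_left_injective (matrixOp_injective e (add_right_injective 1 h))

/-- `stabilize e` is unital, multiplicative, star-preserving and injective, so it both preserves and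
reflects unitarity. -/
theorem stabilize_mem_unitary_iff (e : ι ↪ ℕ) (M : Matrix ι ι ℂ) :
    stabilize e M ∈ unitary (Hilb →L[ℂ] Hilb) ↔ M ∈ unitary (Matrix ι ι ℂ) := by
  rw [Unitary.mem_iff, Unitary.mem_iff, ← stabilize_star, ← stabilize_mul, ← stabilize_mul,
    ← stabilize_one e, (stabilize_injective e).eq_iff, (stabilize_injective e).eq_iff]

/-- The embedding of the unitary matrices indexed by `ι` in `U_∞` given by an embedding
of the index set. -/
noncomputable def unitaryHom (e : ι ↪ ℕ) : unitary (Matrix ι ι ℂ) →* UInf where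
  toFun u := ⟨⟨stabilize e u, (stabilize_mem_unitary_iff e _).2 u.2⟩, by
      obtain ⟨n, hn⟩ := exists_bound_embedding e
      refine ⟨n, fun k hk => ?_⟩
      have : k ∉ Set.range e := by
        rintro ⟨p, rfl⟩
        exact absurd (hn p) (not_lt.2 hk)
      change stdVec k + matrixOp e _ (stdVec k) = stdVec k
      rw [matrixOp_stdVec_of_notMem e _ this, add_zero]⟩
  map_one' := Subtype.ext (Subtype.ext (stabilize_one e))
  map_mul' _ _ := Subtype.ext (Subtype.ext (stabilize_mul e _ _))

theorem toOp_unitaryHom (e : ι ↪ ℕ) (u : unitary (Matrix ι ι ℂ)) :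
    UInf.toOp (unitaryHom e u) = stabilize e u := rfl

theorem continuous_unitaryHom (e : ι ↪ ℕ) : Continuous (unitaryHom e) := by
  refine Continuous.subtype_mk (Continuous.subtype_mk ?_ _) _
  have : Continuous (matrixOpHom e) :=
    AddMonoidHomClass.continuous_of_bound (matrixOpHom e) 1 fun M => by
      simpa using NonUnitalStarAlgHom.norm_apply_le (matrixOpHom e) M
  unfold stabilize
  fun_prop

theorem norm_unitaryHom_sub_le (e : ι ↪ ℕ) (u v : unitary (Matrix ι ι ℂ)) :
    ‖UInf.toOp (unitaryHom e u) - UInf.toOp (unitaryHom e v)‖ ≤ ‖(u : Matrix ι ι ℂ) - v‖ := by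
  rw [toOp_unitaryHom, toOp_unitaryHom, stabilize, stabilize, add_sub_add_left_eq_sub, ← map_sub,
    sub_sub_sub_cancel_right]
  exact NonUnitalStarAlgHom.norm_apply_le (matrixOpHom e) _

/-- The standard embedding of the unitary `n × n` matrices in `U_∞`. -/
noncomputable def finHom (n : ℕ) : unitary (Matrix (Fin n) (Fin n) ℂ) →* UInf :=
  unitaryHom Fin.valEmbedding

/-- Both `u` and its adjoint fix `e_k` for `k ≥ n`; the adjoint's part shows that `u` maps the span
of the first `n` vectors to itself, so `u` is determined by its corner matrix. -/
theorem exists_finHom_eq {n : ℕ} {u : UInf}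
    (hu : (u : unitary (Hilb →L[ℂ] Hilb)) ∈ unitaryFin n) : ∃ a, finHom n a = u := by
  let e : Fin n ↪ ℕ := Fin.valEmbedding
  let a : Matrix (Fin n) (Fin n) ℂ := .of fun p q =>
    inner ℂ (stdVec (p : ℕ)) (UInf.toOp u (stdVec (q : ℕ)))
  have hstar : ∀ k, n ≤ k → star (UInf.toOp u) (stdVec k) = stdVec k :=
    fun k hk => inv_mem hu k hk
  have hop : stabilize e a = UInf.toOp u := by
    refine op_ext fun k => ?_
    change stdVec k + matrixOp e (a - 1) (stdVec k) = _
    by_cases hk : k ∈ Set.range e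
    · obtain ⟨q, rfl⟩ := hk
      rw [matrixOp_stdVec]
      simp only [Matrix.sub_apply, sub_smul, Finset.sum_sub_distrib, Matrix.one_apply, ite_smul,
        one_smul, zero_smul, Finset.sum_ite_eq', Finset.mem_univ, if_true, add_sub_cancel]
      ext j
      have hj : ∀ x : Hilb, x j = inner ℂ (stdVec j) x := fun x => by
        rw [stdVec, lp.inner_single_left]; simp
      rw [hj, hj, inner_sum]
      simp only [inner_smul_right, inner_stdVec]
      by_cases h : j < n
      · rw [Finset.sum_eq_single ⟨j, h⟩]
        · simp [a, e]
        · intro b _ hb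
          rw [if_neg, mul_zero]
          rintro rfl
          exact hb rfl
        · simp
      · rw [Finset.sum_eq_zero]
        · have h1 := ContinuousLinearMap.adjoint_inner_left (UInf.toOp u) (stdVec (e q)) (stdVec j)
          rw [← ContinuousLinearMap.star_eq_adjoint, hstar j (not_lt.1 h), inner_stdVec,
            if_neg] at h1
          · exact h1
          · rintro rfl
            exact h q.2
        · intro b _
          rw [if_neg, mul_zero]
          rintro rfl
          exact h b.2
    · rw [matrixOp_stdVec_of_notMem e _ hk, add_zero]
      refine (hu k ?_).symm
      by_contra! h
      exact hk ⟨⟨k, h⟩, rfl⟩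
  have ha : a ∈ unitary (Matrix (Fin n) (Fin n) ℂ) := by
    rw [← stabilize_mem_unitary_iff e, hop]
    exact (u : unitary (Hilb →L[ℂ] Hilb)).2
  exact ⟨⟨a, ha⟩, Subtype.ext (Subtype.ext hop)⟩

/-! ### Block diagonal and block permutation matrices. -/

/-- Block diagonal unitary matrices. -/
noncomputable def blockHom (n : ℕ) (κ : Type*) [Fintype κ] [DecidableEq κ] :
    (κ → unitary (Matrix (Fin n) (Fin n) ℂ)) →* unitary (Matrix (Fin n × κ) (Fin n × κ) ℂ) where
  toFun x := ⟨Matrix.blockDiagonal fun k => (x k : Matrix (Fin n) (Fin n) ℂ), by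
    have h1 : ∀ k, (x k : Matrix (Fin n) (Fin n) ℂ).conjTranspose * x k = 1 :=
      fun k => Unitary.coe_star_mul_self (x k)
    have h2 : ∀ k, (x k : Matrix (Fin n) (Fin n) ℂ) * (x k : Matrix (Fin n) (Fin n) ℂ).conjTranspose
      = 1 := fun k => Unitary.coe_mul_star_self (x k)
    rw [Unitary.mem_iff, Matrix.star_eq_conjTranspose, Matrix.blockDiagonal_conjTranspose,
      ← Matrix.blockDiagonal_mul, ← Matrix.blockDiagonal_mul]
    simp only [h1, h2]
    exact ⟨Matrix.blockDiagonal_one, Matrix.blockDiagonal_one⟩⟩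
  map_one' := Subtype.ext Matrix.blockDiagonal_one
  map_mul' x y := Subtype.ext (Matrix.blockDiagonal_mul
    (fun k => (x k : Matrix (Fin n) (Fin n) ℂ)) (fun k => (y k : Matrix (Fin n) (Fin n) ℂ)))

section

variable {n : ℕ} {κ : Type*} [Fintype κ] [DecidableEq κ]

theorem coe_blockHom (x : κ → unitary (Matrix (Fin n) (Fin n) ℂ)) :
    (blockHom n κ x : Matrix (Fin n × κ) (Fin n × κ) ℂ) =
      Matrix.blockDiagonal fun k => (x k : Matrix (Fin n) (Fin n) ℂ) := rfl

theorem norm_blockHom_sub_le (x y : κ → unitary (Matrix (Fin n) (Fin n) ℂ)) {r : ℝ} (hr : 0 ≤ r)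
    (h : ∀ k, ‖(x k : Matrix (Fin n) (Fin n) ℂ) - y k‖ ≤ r) :
    ‖(blockHom n κ x : Matrix (Fin n × κ) (Fin n × κ) ℂ) - blockHom n κ y‖ ≤ r := by
  rw [coe_blockHom, coe_blockHom, ← Matrix.blockDiagonal_sub]
  exact (Matrix.norm_blockDiagonal_le _).trans ((pi_norm_le_iff_of_nonneg hr).2 h)

theorem continuous_blockHom : Continuous (blockHom n κ) := by
  refine Continuous.subtype_mk ?_ _
  refine Continuous.matrix_blockDiagonal ?_
  fun_prop

/-- The matrix permuting the blocks by `ρ`. -/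
noncomputable def blockPerm (n : ℕ) (ρ : Equiv.Perm κ) :
    unitary (Matrix (Fin n × κ) (Fin n × κ) ℂ) :=
  ⟨Equiv.Perm.permMatrix ℂ (Equiv.prodCongr (Equiv.refl (Fin n)) ρ), by
    rw [Unitary.mem_iff, Matrix.star_eq_conjTranspose, Matrix.conjTranspose_permMatrix,
      ← Matrix.permMatrix_mul, ← Matrix.permMatrix_mul]
    simp⟩

theorem blockPerm_mul_blockHom (ρ : Equiv.Perm κ) (x : κ → unitary (Matrix (Fin n) (Fin n) ℂ)) :
    blockPerm n ρ * blockHom n κ x = blockHom n κ (x ∘ ρ) * blockPerm n ρ := by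
  apply Subtype.ext
  change Equiv.Perm.permMatrix ℂ (Equiv.prodCongr (Equiv.refl (Fin n)) ρ) *
      Matrix.blockDiagonal (fun k => (x k : Matrix (Fin n) (Fin n) ℂ)) =
    Matrix.blockDiagonal (fun k => (x (ρ k) : Matrix (Fin n) (Fin n) ℂ)) *
      Equiv.Perm.permMatrix ℂ (Equiv.prodCongr (Equiv.refl (Fin n)) ρ)
  rw [Equiv.Perm.permMatrix, PEquiv.toMatrix_toPEquiv_mul, PEquiv.mul_toMatrix_toPEquiv]
  ext ⟨p, i⟩ ⟨q, j⟩
  simp [Matrix.blockDiagonal_apply, Equiv.eq_symm_apply]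

theorem commute_blockPerm (ρ : Equiv.Perm κ) (u : unitary (Matrix (Fin n) (Fin n) ℂ)) :
    Commute (blockHom n κ fun _ => u) (blockPerm n ρ) :=
  (blockPerm_mul_blockHom ρ fun _ => u).symm

end

/-- The enumeration of the basis of a sum of `N + 1` copies of `ℂⁿ`, copy after copy. -/
def blockEmb (n N : ℕ) : Fin n × Fin (N + 1) ↪ ℕ :=
  (Equiv.prodComm _ _).toEmbedding.trans (finProdFinEquiv.toEmbedding.trans Fin.valEmbedding)

theorem blockEmb_zero (n N : ℕ) (p : Fin n) : blockEmb n N (p, 0) = p := by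
  simp [blockEmb]

/-- Block `0` occupies the first `n` basis vectors and the other blocks are `1`, so adding blocks
does not change the element of `U_∞`. -/
theorem unitaryHom_blockHom_mulSingle (n N : ℕ) (a : unitary (Matrix (Fin n) (Fin n) ℂ)) :
    unitaryHom (blockEmb n N) (blockHom n (Fin (N + 1)) (Pi.mulSingle 0 a)) = finHom n a := by
  apply Subtype.ext
  apply Subtype.ext
  change UInf.toOp _ = UInf.toOp (unitaryHom Fin.valEmbedding a)
  rw [toOp_unitaryHom, toOp_unitaryHom, stabilize, stabilize, matrixOpHom_apply,
    matrixOpHom_apply, coe_blockHom]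
  congr 1
  have h : (Matrix.blockDiagonal fun k =>
      ((Pi.mulSingle 0 a : Fin (N + 1) → unitary (Matrix (Fin n) (Fin n) ℂ)) k :
        Matrix (Fin n) (Fin n) ℂ)) - 1 =
      Matrix.blockDiagonal (Pi.single 0 ((a : Matrix (Fin n) (Fin n) ℂ) - 1)) := by
    rw [← Matrix.blockDiagonal_one, ← Matrix.blockDiagonal_sub]
    congr 1
    funext k
    by_cases hk : k = 0
    · subst hk; simp
    · simp [hk]
  rw [h]
  unfold matrixOp
  rw [Fintype.sum_prod_type]
  refine Finset.sum_congr rfl fun p _ => ?_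
  rw [Finset.sum_eq_single 0 _ (by simp)]
  · rw [Fintype.sum_prod_type]
    refine Finset.sum_congr rfl fun q _ => ?_
    rw [Finset.sum_eq_single 0 _ (by simp)]
    · simp [blockEmb_zero]
    · intro j _ hj
      simp [Matrix.blockDiagonal_apply, hj.symm]
  · intro i _ hi
    refine Finset.sum_eq_zero fun q _ => ?_
    simp [Matrix.blockDiagonal_apply, hi]

/-! ### Approximate lifting of paths of commutators. -/

theorem joinedIn_of_continuous {X : Type*} [TopologicalSpace X] {F : Set X} {x y : X}
    {f : unitInterval → X} (hf : Continuous f) (h0 : f 0 = x) (h1 : f 1 = y)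
    (h : ∀ t, f t ∈ F) : JoinedIn F x y :=
  ⟨⟨⟨f, hf⟩, h0, h1⟩, h⟩

theorem commutatorElement_mul_right_of_commute {G : Type*} [Group G] {a b c : G}
    (h : Commute a c) : ⁅a, b * c⁆ = ⁅a, b⁆ := by
  have h1 : c * a⁻¹ * c⁻¹ = a⁻¹ := by rw [← h.inv_left.eq, mul_inv_cancel_right]
  calc ⁅a, b * c⁆ = a * b * (c * a⁻¹ * c⁻¹) * b⁻¹ := by rw [commutatorElement_def]; group
    _ = _ := by rw [h1, commutatorElement_def]

variable {n : ℕ}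

/-- The pair `(u ⊕ 1, v ⊕ 1)` can be moved to `(u ⊕ ⋯ ⊕ u, (v ⊕ 1) V)`, where `V` permutes the
blocks, with constant commutator. -/
theorem joinedIn_blockPerm (N : ℕ) (ρ : Equiv.Perm (Fin (N + 1)))
    (u v : unitary (Matrix (Fin n) (Fin n) ℂ)) :
    JoinedIn {p | ⁅p.1, p.2⁆ = blockHom n (Fin (N + 1)) (Pi.mulSingle 0 ⁅u, v⁆)}
      (blockHom n (Fin (N + 1)) (Pi.mulSingle 0 u), blockHom n (Fin (N + 1)) (Pi.mulSingle 0 v))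
      (blockHom n (Fin (N + 1)) fun _ => u,
        blockHom n (Fin (N + 1)) (Pi.mulSingle 0 v) * blockPerm n ρ) := by
  -- Away from block `0` the second entry is `1`, so the blocks of the first entry are free there.
  have key : ∀ f : Fin (N + 1) → unitary (Matrix (Fin n) (Fin n) ℂ), f 0 = u →
      ⁅blockHom n (Fin (N + 1)) f, blockHom n (Fin (N + 1)) (Pi.mulSingle 0 v)⁆ =
        blockHom n (Fin (N + 1)) (Pi.mulSingle 0 ⁅u, v⁆) := by
    intro f hf
    rw [← map_commutatorElement]
    congr 1
    funext k
    by_cases hk : k = 0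
    · subst hk; simp [commutatorElement_def, hf]
    · simp [commutatorElement_def, hk]
  obtain ⟨x⟩ := PathConnectedSpace.joined (1 : unitary (Matrix (Fin n) (Fin n) ℂ)) u
  -- The whole path from `1` to the permutation matrix commutes with `u ⊕ ⋯ ⊕ u`.
  obtain ⟨γ, hγ⟩ := Unitary.exists_path_commute (blockPerm n ρ) (Matrix.finite_spectrum _)
  refine (joinedIn_of_continuous (y := (blockHom n (Fin (N + 1)) fun _ => u,
      blockHom n (Fin (N + 1)) (Pi.mulSingle 0 v)))
    (f := fun t => (blockHom n (Fin (N + 1)) (Function.update (fun _ => x t) 0 u),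
      blockHom n (Fin (N + 1)) (Pi.mulSingle 0 v))) ?_ ?_ ?_ ?_).trans
    (joinedIn_of_continuous (f := fun t => (blockHom n (Fin (N + 1)) fun _ => u,
        blockHom n (Fin (N + 1)) (Pi.mulSingle 0 v) * γ t)) ?_ ?_ ?_ ?_)
  · refine (continuous_blockHom.comp ?_).prodMk continuous_const
    exact (continuous_pi fun _ => x.continuous).update 0 continuous_const
  · simp only [x.source]; rfl
  · simp
  · intro t
    exact key _ (by simp)
  · exact continuous_const.prodMk (continuous_const.mul γ.continuous)
  · simp
  · simp
  · intro t
    change ⁅_, _⁆ = _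
    rw [commutatorElement_mul_right_of_commute (hγ t _ (commute_blockPerm ρ u))]
    exact key _ rfl

/-- Along paths of commutators starting at `⁅u, v⁆` one can, after stabilization and a
deformation of `(u, v)` with constant commutator, move `u` with approximately the prescribed
commutators. -/
theorem exists_commutator_lift (u v : unitary (Matrix (Fin n) (Fin n) ℂ))
    (C : C(unitInterval, unitary (Matrix (Fin n) (Fin n) ℂ))) (hC : C 0 = ⁅u, v⁆)
    {η : ℝ} (hη : 0 < η) :
    ∃ u' v' : UInf,
      JoinedIn {p : UInf × UInf | ⁅p.1, p.2⁆ = finHom n ⁅u, v⁆} (finHom n u, finHom n v) (u', v') ∧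
      ∃ p : C(unitInterval, UInf), p 0 = u' ∧
        ∀ s, ‖UInf.toOp ⁅p s, v'⁆ - UInf.toOp (finHom n (C s))‖ ≤ η := by
  obtain ⟨δ, hδ, hCδ⟩ := Metric.uniformContinuous_iff.1
    (CompactSpace.uniformContinuous_of_continuous C.continuous) η hη
  obtain ⟨N, hN⟩ := exists_nat_one_div_lt hδ
  -- The cyclic shift `j ↦ j - 1`, sending `0` to the last block. The parameters `τ j = 1 - j / (N +
  -- 1)` descend from `1` to `0` in `N + 1` steps shorter than `δ`.
  let ρ : Equiv.Perm (Fin (N + 1 + 1)) := Equiv.subRight 1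
  let Φ := unitaryHom (blockEmb n (N + 1))
  let B := blockHom n (Fin (N + 1 + 1))
  let τ : Fin (N + 1 + 1) → unitInterval := fun j => unitInterval.symm
    ⟨(j : ℕ) / ((N : ℝ) + 1), by positivity, by
      rw [div_le_one (by positivity)]
      exact_mod_cast Nat.le_of_lt_succ j.2⟩
  -- The factor `v u v⁻¹` makes `f 0` constantly `u`, and it cancels in the quotient of two
  -- neighbouring blocks.
  let f : unitInterval → Fin (N + 1 + 1) → unitary (Matrix (Fin n) (Fin n) ℂ) :=
    fun s j => C (s * τ j) * (v * u * v⁻¹)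
  let g : Fin (N + 1 + 1) → unitary (Matrix (Fin n) (Fin n) ℂ) := Pi.mulSingle 0 v
  have hu : C 0 * (v * u * v⁻¹) = u := by rw [hC, commutatorElement_def]; group
  have hΦ : ∀ a, Φ (B (Pi.mulSingle 0 a)) = finHom n a := unitaryHom_blockHom_mulSingle n (N + 1)
  refine ⟨Φ (B fun _ => u), Φ (B g * blockPerm n ρ), ?_,
    ⟨fun s => Φ (B (f s)), ?_⟩, ?_, ?_⟩
  · have h := joinedIn_blockPerm (N + 1) ρ u v
    obtain ⟨γ, hγ⟩ := h
    refine joinedIn_of_continuous (f := fun t => (Φ (γ t).1, Φ (γ t).2)) ?_ ?_ ?_ ?_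
    · have := continuous_unitaryHom (blockEmb n (N + 1))
      exact (this.comp (continuous_fst.comp γ.continuous)).prodMk
        (this.comp (continuous_snd.comp γ.continuous))
    · simp only [γ.source]
      rw [← hΦ, ← hΦ]
    · simp only [γ.target]; rfl
    · intro t
      change ⁅Φ _, Φ _⁆ = _
      rw [← map_commutatorElement, ← hΦ]
      exact congrArg Φ (hγ t)
  · refine (continuous_unitaryHom _).comp (continuous_blockHom.comp ?_)
    refine continuous_pi fun j => ?_
    fun_prop
  · change Φ (B (f 0)) = _
    simp only [f, zero_mul, hu]
  · intro s
    change ‖UInf.toOp ⁅Φ (B (f s)), Φ (B g * blockPerm n ρ)⁆ - _‖ ≤ η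
    -- Conjugating by the permutation shifts the blocks, so the commutator is block diagonal.
    have hcomm : ⁅B (f s), B g * blockPerm n ρ⁆ =
        B (f s * g * (f s ∘ ρ)⁻¹ * g⁻¹) := by
      have h := blockPerm_mul_blockHom ρ (f s)⁻¹
      simp only [map_mul, map_inv]
      rw [commutatorElement_def, mul_inv_rev]
      have h2 : blockPerm n ρ * (B (f s))⁻¹ * (blockPerm n ρ)⁻¹ = (B (f s ∘ ρ))⁻¹ := by
        rw [← map_inv, ← map_inv, h, mul_inv_cancel_right]; rfl
      rw [← h2]
      group
    rw [← map_commutatorElement, hcomm, ← hΦ]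
    refine (norm_unitaryHom_sub_le _ _ _).trans (norm_blockHom_sub_le _ _ hη.le fun k => ?_)
    by_cases hk : k = 0
    · subst hk
      have h0 : τ 0 = 1 := by
        apply Subtype.ext; simp [τ]
      have h1 : τ (ρ 0) = 0 := by
        apply Subtype.ext
        have : ρ 0 = Fin.last (N + 1) := by
          rw [Equiv.subRight_apply, zero_sub]
          exact Fin.ext (by simp [Fin.coe_neg_one])
        simp only [τ, this, Fin.val_last, unitInterval.coe_symm_eq]
        push_cast
        rw [div_self (by positivity)]; simp
      -- At the wrap-around the neighbouring block is `u`, and the result is exact.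
      have : (f s * g * (f s ∘ ρ)⁻¹ * g⁻¹) 0 = C s := by
        simp only [Pi.mul_apply, Pi.inv_apply, Function.comp, f, g, h0, h1, mul_zero, mul_one, hu,
          Pi.mulSingle_eq_same]
        group
      rw [this, Pi.mulSingle_eq_same, sub_self, norm_zero]
      exact hη.le
    · have : (f s * g * (f s ∘ ρ)⁻¹ * g⁻¹) k =
          C (s * τ k) * (C (s * τ (ρ k)))⁻¹ := by
        simp only [Pi.mul_apply, Pi.inv_apply, Function.comp, f, g, Pi.mulSingle_eq_of_ne hk]
        group
      rw [this, Pi.mulSingle_eq_of_ne hk]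
      have hd : dist (C (s * τ k)) (C (s * τ (ρ k))) < η := by
        refine hCδ (lt_of_le_of_lt ?_ hN)
        obtain ⟨j, rfl⟩ := Fin.exists_succ_eq.2 hk
        have hρ : ((ρ j.succ : Fin (N + 1 + 1)) : ℕ) = j := by
          have : ρ j.succ = j.castSucc := by simp [ρ, sub_eq_iff_eq_add]
          rw [this]; rfl
        have hτ : ∀ j, (τ j : ℝ) = 1 - (j : ℕ) / ((N : ℝ) + 1) := fun _ => rfl
        rw [Subtype.dist_eq, Real.dist_eq, Set.Icc.coe_mul, Set.Icc.coe_mul, ← mul_sub, abs_mul,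
          abs_of_nonneg s.2.1]
        refine (mul_le_of_le_one_left (abs_nonneg _) s.2.2).trans (le_of_eq ?_)
        rw [hτ, hτ, hρ, Fin.val_succ,
          show (1 - ((j : ℕ) + 1 : ℕ) / ((N : ℝ) + 1) - (1 - (j : ℕ) / ((N : ℝ) + 1)) : ℝ)
            = -(1 / ((N : ℝ) + 1)) by push_cast; ring, abs_neg, abs_of_pos (by positivity)]
      rw [Subtype.dist_eq, dist_eq_norm, Unitary.norm_sub_eq] at hd
      exact hd.le

/-! ### The surface relator and its deviation. -/

/-- The product of the commutators of the pairs `x (inl i), x (inr i)`. -/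
def surfaceProd {G : Type*} [Group G] {m : ℕ} (x : SurfaceGen m → G) : G :=
  (List.ofFn fun i : Fin m => ⁅x (Sum.inl i), x (Sum.inr i)⁆).prod

theorem map_surfaceProd {G H : Type*} [Group G] [Group H] {m : ℕ} (φ : G →* H)
    (x : SurfaceGen m → G) : φ (surfaceProd x) = surfaceProd (φ ∘ x) := by
  simp only [surfaceProd, map_list_prod, List.map_ofFn, Function.comp_def, map_commutatorElement]

theorem lift_surfaceWord {G : Type*} [Group G] {m : ℕ} (x : SurfaceGen m → G) :
    FreeGroup.lift x (surfaceWord m) = surfaceProd x := by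
  have h : surfaceWord m = surfaceProd FreeGroup.of := rfl
  rw [h, map_surfaceProd]
  congr 1
  funext i
  simp

theorem surfaceProd_one {G : Type*} [Group G] {m : ℕ} :
    surfaceProd (1 : SurfaceGen m → G) = 1 := by
  simp [surfaceProd, List.ofFn_const]

theorem continuous_surfaceProd {G : Type*} [Group G] [TopologicalSpace G] [IsTopologicalGroup G]
    {m : ℕ} : Continuous (surfaceProd : (SurfaceGen m → G) → G) := by
  unfold surfaceProd
  simp only [List.ofFn_eq_map, commutatorElement_def]
  refine continuous_list_prod _ fun i _ => ?_
  fun_prop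

/-- The tuple with the pair `p` in front of the tuple `y`. -/
def consPair {G : Type*} {k : ℕ} (p : G × G) (y : SurfaceGen k → G) : SurfaceGen (k + 1) → G :=
  Sum.elim (Fin.cons p.1 fun i => y (Sum.inl i)) (Fin.cons p.2 fun i => y (Sum.inr i))

/-- The tuple without the first pair. -/
def tailPairs {G : Type*} {k : ℕ} (x : SurfaceGen (k + 1) → G) : SurfaceGen k → G :=
  Sum.elim (fun i => x (Sum.inl i.succ)) (fun i => x (Sum.inr i.succ))

theorem consPair_tailPairs {G : Type*} {k : ℕ} (x : SurfaceGen (k + 1) → G) :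
    consPair (x (Sum.inl 0), x (Sum.inr 0)) (tailPairs x) = x := by
  funext i
  rcases i with i | i <;> refine Fin.cases ?_ (fun j => ?_) i <;> rfl

theorem surfaceProd_consPair {G : Type*} [Group G] {k : ℕ} (p : G × G) (y : SurfaceGen k → G) :
    surfaceProd (consPair p y) = ⁅p.1, p.2⁆ * surfaceProd y := by
  simp [surfaceProd, consPair, List.ofFn_succ]

theorem continuous_consPair {G : Type*} [TopologicalSpace G] {k : ℕ} :
    Continuous fun q : (G × G) × (SurfaceGen k → G) => consPair q.1 q.2 := by
  refine continuous_pi fun i => ?_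
  rcases i with i | i <;> refine Fin.cases ?_ (fun j => ?_) i <;>
    simp only [consPair, Sum.elim_inl, Sum.elim_inr, Fin.cons_zero, Fin.cons_succ] <;> fun_prop

theorem relDefect_surfaceWord {m : ℕ} (σ : SurfaceGen m → UInf) :
    relDefect σ (surfaceWord m) = ‖UInf.toOp (surfaceProd σ) - 1‖ := by
  rw [relDefect, lift_surfaceWord]

theorem mem_almostReps_surfaceRels {m : ℕ} {σ : SurfaceGen m → UInf} {ε : ℝ} :
    σ ∈ almostReps (surfaceRels m) ε ↔ ‖UInf.toOp (surfaceProd σ) - 1‖ ≤ ε := by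
  simp [almostReps, surfaceRels, relDefect_surfaceWord]

theorem deviation_singleton {α : Type} (r : FreeGroup α) (σ : α → UInf) :
    deviation {r} σ = relDefect σ r :=
  haveI : Subsingleton ({r} : Finset (FreeGroup α)) :=
    ⟨fun a b => Subtype.ext ((Finset.mem_singleton.1 a.2).trans (Finset.mem_singleton.1 b.2).symm)⟩
  ciSup_subsingleton (⟨r, Finset.mem_singleton_self r⟩ : ({r} : Finset (FreeGroup α)))
    fun r => relDefect σ (r : FreeGroup α)

theorem deviation_surfaceRels {m : ℕ} (σ : SurfaceGen m → UInf) :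
    deviation (surfaceRels m) σ = ‖UInf.toOp (surfaceProd σ) - 1‖ := by
  rw [surfaceRels, deviation_singleton, relDefect_surfaceWord]

theorem deviation_zSqRels (σ : Fin 2 → UInf) :
    deviation zSqRels σ = ‖UInf.toOp ⁅σ 0, σ 1⁆ - 1‖ := by
  rw [zSqRels, deviation_singleton, relDefect]
  simp [commutatorElement_def]

theorem mem_almostReps_zSqRels {σ : Fin 2 → UInf} {ε : ℝ} :
    σ ∈ almostReps zSqRels ε ↔ ‖UInf.toOp ⁅σ 0, σ 1⁆ - 1‖ ≤ ε := by
  simp [almostReps, zSqRels, relDefect, commutatorElement_def]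

/-! ### Reduction to one pair of generators, and AGA. -/

theorem exists_lift_finHom {ι : Type*} [Fintype ι] (σ : ι → UInf) :
    ∃ n, ∃ a : ι → unitary (Matrix (Fin n) (Fin n) ℂ), finHom n ∘ a = σ := by
  choose N hN using fun i => (σ i).2
  have h : ∀ i, ∃ a, finHom (Finset.univ.sup N) a = σ i := fun i =>
    exists_finHom_eq (unitaryFin_mono (Finset.le_sup (Finset.mem_univ i)) (hN i))
  choose a ha using h
  exact ⟨_, a, funext ha⟩

theorem norm_toOp_mul_sub_mul (u v w : UInf) :
    ‖UInf.toOp (u * w) - UInf.toOp (v * w)‖ = ‖UInf.toOp u - UInf.toOp v‖ := by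
  change ‖UInf.toOp u * UInf.toOp w - UInf.toOp v * UInf.toOp w‖ = _
  rw [← sub_mul]
  exact CStarRing.norm_mul_coe_unitary _ (w : unitary (Hilb →L[ℂ] Hilb))

/-- Up to a factor `2`, almost representations of the surface group can be connected with
those which are trivial except on the first pair of generators. -/
theorem exists_joinedIn_consPair_one {k : ℕ} {ε : ℝ} (hε : 0 < ε) {σ : SurfaceGen (k + 1) → UInf}
    (hσ : σ ∈ almostReps (surfaceRels (k + 1)) ε) :
    ∃ p : UInf × UInf, JoinedIn (almostReps (surfaceRels (k + 1)) (2 * ε)) σ (consPair p 1) := by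
  obtain ⟨n, a, rfl⟩ := exists_lift_finHom σ
  rw [mem_almostReps_surfaceRels, ← map_surfaceProd] at hσ
  let u := a (Sum.inl 0)
  let v := a (Sum.inr 0)
  obtain ⟨x⟩ := PathConnectedSpace.joined (tailPairs a) 1
  have ha : surfaceProd a = ⁅u, v⁆ * surfaceProd (tailPairs a) := by
    conv_lhs => rw [← consPair_tailPairs a]
    exact surfaceProd_consPair _ _
  -- The commutator needed in front of the contracted tail to keep the full product equal to
  -- `surfaceProd a`.
  let C : C(unitInterval, unitary (Matrix (Fin n) (Fin n) ℂ)) :=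
    ⟨fun s => surfaceProd a * (surfaceProd (x s))⁻¹,
      continuous_const.mul (continuous_surfaceProd.comp x.continuous).inv⟩
  have hC : C 0 = ⁅u, v⁆ := by
    change surfaceProd a * (surfaceProd (x 0))⁻¹ = _
    rw [x.source, ha, mul_inv_cancel_right]
  obtain ⟨u', v', ⟨γ, hγ⟩, p, hp, hpC⟩ := exists_commutator_lift u v C hC hε
  have hcons : Continuous fun q : (UInf × UInf) × (SurfaceGen k → UInf) => consPair q.1 q.2 :=
    continuous_consPair
  have hfin : Continuous (finHom n) := continuous_unitaryHom _
  refine ⟨(p 1, v'), (joinedIn_of_continuous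
    (f := fun t => consPair (γ t) (finHom n ∘ tailPairs a)) (y := consPair (u', v')
      (finHom n ∘ tailPairs a)) ?_ ?_ ?_ ?_).trans (joinedIn_of_continuous
    (f := fun s => consPair (p s, v') (finHom n ∘ x s)) ?_ ?_ ?_ ?_)⟩
  · exact hcons.comp (γ.continuous.prodMk
      (continuous_const (y := (finHom n ∘ tailPairs a : SurfaceGen k → UInf))))
  · simp only [γ.source]
    rw [← consPair_tailPairs (finHom n ∘ a)]
    congr 1
    funext i
    rcases i with i | i <;> rfl
  · simp only [γ.target]
  · intro t
    have : ⁅(γ t).1, (γ t).2⁆ = finHom n ⁅u, v⁆ := hγ t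
    rw [mem_almostReps_surfaceRels, surfaceProd_consPair, this, ← map_surfaceProd, ← map_mul, ← ha]
    linarith
  · have hx : Continuous fun s => (finHom n ∘ x s : SurfaceGen k → UInf) :=
      continuous_pi fun i => hfin.comp ((continuous_apply i).comp x.continuous)
    exact hcons.comp ((p.continuous.prodMk (continuous_const (y := v'))).prodMk hx)
  · simp only [x.source, hp]
  · simp only [x.target]
    congr 1
    funext i
    exact map_one _
  · intro s
    rw [mem_almostReps_surfaceRels, surfaceProd_consPair, ← map_surfaceProd]
    have h1 : finHom n (surfaceProd a) = finHom n (C s) * finHom n (surfaceProd (x s)) := by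
      rw [← map_mul]
      congr 1
      exact (inv_mul_cancel_right _ _).symm
    have h2 := norm_toOp_mul_sub_mul ⁅p s, v'⁆ (finHom n (C s)) (finHom n (surfaceProd (x s)))
    rw [← h1] at h2
    have h3 := hpC s
    rw [← h2] at h3
    calc _ ≤ _ := norm_sub_le_norm_sub_add_norm_sub _ (UInf.toOp (finHom n (surfaceProd a))) _
      _ ≤ ε + ε := add_le_add h3 hσ
      _ = 2 * ε := (two_mul ε).symm

theorem hasAGA_surfaceRels_zero : HasAGA (surfaceRels 0) := by
  have h : ∀ σ : SurfaceGen 0 → UInf, deviation (surfaceRels 0) σ = 0 := fun σ => by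
    rw [deviation_surfaceRels, show surfaceProd σ = 1 by simp [surfaceProd]]
    exact (congrArg norm (sub_self _)).trans norm_zero
  refine ⟨id, tendsto_nhdsWithin_of_tendsto_nhds tendsto_id, fun ε hε σ _ =>
    ⟨fun _ => σ, ⟨continuous_const, ?_⟩, rfl, fun t => ?_⟩⟩
  · simp only [h]
    exact tendsto_const_nhds
  · rw [h]
    exact hε.le

/-- Follow the path to a tuple trivial beyond the first pair, then the asymptotic representation of
`ℤ²` through that pair. The first leg costs `2 * ε`, the second `δ (2 * ε)`, whence the maximum. -/
theorem HasAGA.surfaceRels_succ (h : HasAGA zSqRels) (k : ℕ) : HasAGA (surfaceRels (k + 1)) := by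
  obtain ⟨δ, hδ, H⟩ := h
  have h2 : Tendsto (fun ε : ℝ => 2 * ε) (𝓝[>] 0) (𝓝[>] 0) := by
    refine tendsto_nhdsWithin_iff.2 ⟨tendsto_nhdsWithin_of_tendsto_nhds ?_, ?_⟩
    · exact (continuous_const_mul (2 : ℝ)).tendsto' 0 0 (mul_zero 2)
    · filter_upwards [self_mem_nhdsWithin] with ε hε
      exact mul_pos (two_pos (α := ℝ)) (Set.mem_Ioi.1 hε)
  refine ⟨fun ε => max (2 * ε) (δ (2 * ε)), ?_, fun ε hε σ hσ => ?_⟩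
  · simpa using (h2.mono_right nhdsWithin_le_nhds).max (hδ.comp h2)
  obtain ⟨p, γ, hγ⟩ := exists_joinedIn_consPair_one hε hσ
  have hdev : ∀ f : Fin 2 → UInf,
      deviation (surfaceRels (k + 1)) (consPair (f 0, f 1) 1) = deviation zSqRels f := fun f => by
    rw [deviation_surfaceRels, surfaceProd_consPair, surfaceProd_one, mul_one, deviation_zSqRels]
  have hp : ![p.1, p.2] ∈ almostReps zSqRels (2 * ε) := by
    have := hγ 1
    rw [γ.target, mem_almostReps_surfaceRels, surfaceProd_consPair, surfaceProd_one, mul_one]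
      at this
    exact mem_almostReps_zSqRels.2 this
  obtain ⟨s, ⟨hs, hs'⟩, hs0, hsδ⟩ := H (2 * ε) (by positivity) _ hp
  -- The legs agree at `t = 1`, where `s (t - 1) = s 0` is the endpoint of `γ`.
  let ρ : ℝ≥0 → SurfaceGen (k + 1) → UInf := fun t =>
    if t ≤ 1 then γ.extend t else consPair (s (t - 1) 0, s (t - 1) 1) 1
  have hρ : ∀ t, deviation (surfaceRels (k + 1)) (ρ t) ≤ 2 * ε ∨
      deviation (surfaceRels (k + 1)) (ρ t) = deviation zSqRels (s (t - 1)) := by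
    intro t
    by_cases ht : t ≤ 1
    · left
      simp only [ρ, if_pos ht]
      rw [deviation_surfaceRels, ← mem_almostReps_surfaceRels]
      exact hγ _
    · right
      simp only [ρ, if_neg ht, hdev]
  refine ⟨ρ, ⟨?_, ?_⟩, ?_, fun t => ?_⟩
  · refine Continuous.if_le (γ.continuous_extend.comp NNReal.continuous_coe) ?_ continuous_id
      continuous_const ?_
    · have h1 : Continuous fun t : ℝ≥0 => s (t - 1) := hs.comp (by fun_prop)
      exact continuous_consPair.comp ((((continuous_apply 0).comp h1).prodMk
        ((continuous_apply 1).comp h1)).prodMk continuous_const)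
    · rintro t rfl
      simp [hs0]
  · have h1 : Tendsto (fun t : ℝ≥0 => t - 1) atTop atTop :=
      tendsto_atTop_atTop.2 fun b => ⟨b + 1, fun t ht => le_tsub_of_add_le_right ht⟩
    refine (hs'.comp h1).congr' ?_
    filter_upwards [eventually_gt_atTop 1] with t ht
    simp only [ρ, if_neg (not_le.2 ht), hdev, Function.comp]
  · simp [ρ]
  · rcases hρ t with h | h
    · exact h.trans (le_max_left _ _)
    · exact (h.trans_le (hsδ _)).trans (le_max_right _ _)

end AGA

theorem mainTheorem5 (m : ℕ) :
    (∀ ε : ℝ, 0 < ε → ∀ σ ∈ AGA.almostReps (AGA.surfaceRels m) ε,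
      ∃ τ ∈ AGA.almostReps (AGA.surfaceRels m) (2 * ε),
        (∀ i : Fin m, 1 ≤ (i : ℕ) → τ (Sum.inl i) = 1 ∧ τ (Sum.inr i) = 1) ∧
        JoinedIn (AGA.almostReps (AGA.surfaceRels m) (2 * ε)) σ τ) ∧
    (AGA.HasAGA AGA.zSqRels → AGA.HasAGA (AGA.surfaceRels m)) := by
  cases m with
  | zero =>
    refine ⟨fun ε hε σ hσ => ?_, fun _ => AGA.hasAGA_surfaceRels_zero⟩
    have : σ ∈ AGA.almostReps (AGA.surfaceRels 0) (2 * ε) :=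
      fun r hr => (hσ r hr).trans (by linarith)
    exact ⟨σ, this, fun i => i.elim0, JoinedIn.refl this⟩
  | succ k =>
    refine ⟨fun ε hε σ hσ => ?_, fun h => h.surfaceRels_succ k⟩
    obtain ⟨p, hp⟩ := AGA.exists_joinedIn_consPair_one hε hσ
    refine ⟨_, hp.target_mem, fun i => ?_, hp⟩
    refine Fin.cases (fun h => absurd h (by simp)) (fun j _ => ⟨rfl, rfl⟩) i
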